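/- Throughout, vector lattices are real and Archimedean. An $f$-algebra is a vector lattice $A$ with an associative bilinear multiplication (no unit is required) such that products of positive elements are positive and $a\wedge b=0$, $c\ge 0$ imply $(ac)\wedge b=(ca)\wedge b=0$. It is uniformly complete if for every $u\ge 0$ each $u$-uniform Cauchy sequence has a $u$-uniform limit, and semiprime if $0$ is its only nilpotent element. It has the weak factorization property if for every $a\in A$ there are $b,c\in A$ with $a\le bc$. An element $\varphi$ of a vector lattice $V$ is finite if there is $z\in V$, $z\ge 0$, such that for every $x\in V$ there is $c_x>0$ with $|x|\wedge n|\varphi|\le c_x z$ for all $n\in\mathbb N$; $\Phi_1(V)$ is the set of all finite elements of $V$. For $p\ge 2$ let $\Pi_p(A)=\{g_1\cdots g_p : g_1,\dots,g_p\in A\}$, with the order and the algebraic operations inherited from $A$; for a uniformly complete $f$-algebra $A$ it is a vector lattice in its own right, and $\Phi_1(\Pi_p(A))$ is formed with its own lattice operations. Let $A$ be a uniformly complete $f$-algebra and let $p\ge 2$ be an integer. Then 1. if $g_1,\dots,g_p$ are finite in $A$, then $g_1\cdots g_p$ is finite in $\Pi_p(A)$. If, in addition, $A$ is semiprime, then 2.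 if $g_1\cdots g_p$ (with $g_1,\dots,g_p\in A$) is finite in $\Pi_p(A)$, then its $p$-th root is finite in $A$; precisely: $|g_1\cdots g_p|$ has a unique $p$-th root $r\ge 0$ in $A$, and every element of $A$ whose $p$-th power is $|g_1\cdots g_p|$ or $g_1\cdots g_p$ is finite in $A$ (for $g_1\cdots g_p\ge 0$, in particular for $g_1,\dots,g_p\ge 0$, this says that $(g_1\cdots g_p)^{1/p}$ exists and is finite in $A$); 3. if $g_1,\dots,g_p$ are finite in $A$, then the $p$-th root of $g_1\cdots g_p$ is finite in $A$, in the same sense as in 2; 4. $\Phi_1(\Pi_p(A))\subseteq\Phi_1(A)$; 5. if $A$ has the weak factorization property, then $\Phi_1(\Pi_p(A))=\Phi_1(A)\cap\Pi_p(A)$. -/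

import Mathlib

namespace FAlgebra

/-! ### Vector lattices: Archimedean property, uniform completeness -/

section VectorLattice

variable (V : Type*) [AddCommGroup V] [Lattice V] [IsOrderedAddMonoid V] [Module ℝ V]

/-- A vector lattice is Archimedean if `0 ≤ x`, `0 ≤ y` and `n x ≤ y` for all `n` force `x = 0`.
(Mathlib's `Archimedean` is a much stronger property.) -/
def IsArchimedean : Prop :=
  ∀ x y : V, 0 ≤ x → 0 ≤ y → (∀ n : ℕ, n • x ≤ y) → x = 0

/-- Relative uniform completeness: for every `u ≥ 0`, every `u`-uniform Cauchy sequence has a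
`u`-uniform limit. -/
def IsUniformlyComplete : Prop :=
  ∀ u : V, 0 ≤ u → ∀ x : ℕ → V,
    (∀ ε : ℝ, 0 < ε → ∃ N : ℕ, ∀ m ≥ N, ∀ n ≥ N, |x m - x n| ≤ ε • u) →
    ∃ l : V, ∀ ε : ℝ, 0 < ε → ∃ N : ℕ, ∀ n ≥ N, |x n - l| ≤ ε • u

variable {V}

/-! ### Finite elements of a vector lattice -/

/-- `z` is a majorant of `φ` in the vector lattice `V`. -/
def IsMajorant (φ z : V) : Prop :=
  0 ≤ z ∧ ∀ x : V, ∃ c : ℝ, 0 < c ∧ ∀ n : ℕ, |x| ⊓ n • |φ| ≤ c • z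

variable (V) in
/-- The set `Φ₁(V)` of all finite elements of `V`. -/
def finiteElements : Set V := {φ | ∃ z : V, IsMajorant φ z}

/-! ### Finite elements of a subset with the inherited order and algebraic operations

The lattice operations below are those of the subset `S` with the order inherited from `V`;
they are not taken to be the ones of `V`. -/

/-- `m` is the modulus of `x` in `S`: the least upper bound of `x` and `-x` inside `S`. -/
def IsModulusIn (S : Set V) (x m : V) : Prop :=
  m ∈ S ∧ x ≤ m ∧ -x ≤ m ∧ ∀ y ∈ S, x ≤ y → -x ≤ y → m ≤ y

/-- `w` is the infimum of `a` and `b` in `S`: the greatest lower bound inside `S`. -/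
def IsInfIn (S : Set V) (a b w : V) : Prop :=
  w ∈ S ∧ w ≤ a ∧ w ≤ b ∧ ∀ y ∈ S, y ≤ a → y ≤ b → y ≤ w

/-- `z` is a majorant of `φ` in `S`: `z ∈ S`, `z ≥ 0`, and for each `x ∈ S` there is `c > 0` with
`|x| ∧ n|φ| ≤ c z` for all `n`, where modulus and infimum are formed (and exist) in `S`. -/
def IsMajorantIn (S : Set V) (φ z : V) : Prop :=
  z ∈ S ∧ 0 ≤ z ∧ ∀ x ∈ S, ∃ c : ℝ, 0 < c ∧ ∀ n : ℕ,
    ∃ a m w : V, IsModulusIn S x a ∧ IsModulusIn S φ m ∧ IsInfIn S a (n • m) w ∧ w ≤ c • z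

/-- The set `Φ₁(S)` of all finite elements of `S`, for `S` with the inherited order. -/
def finiteElementsIn (S : Set V) : Set V := {φ | φ ∈ S ∧ ∃ z : V, IsMajorantIn S φ z}

/-- On all of `V` the two notions of finite element agree. -/
theorem finiteElementsIn_univ : finiteElementsIn (Set.univ : Set V) = finiteElements V := by
  have hmod : ∀ x : V, IsModulusIn Set.univ x |x| := fun x =>
    ⟨Set.mem_univ _, le_abs_self x, neg_le_abs x, fun y _ h1 h2 => abs_le'.2 ⟨h1, h2⟩⟩
  have hinf : ∀ a b : V, IsInfIn Set.univ a b (a ⊓ b) := fun a b =>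
    ⟨Set.mem_univ _, inf_le_left, inf_le_right, fun y _ h1 h2 => le_inf h1 h2⟩
  ext φ
  constructor
  · rintro ⟨-, z, -, hz, h⟩
    refine ⟨z, hz, fun x => ?_⟩
    obtain ⟨c, hc, hn⟩ := h x (Set.mem_univ _)
    refine ⟨c, hc, fun n => ?_⟩
    obtain ⟨a, m, w, ha, hm, hw, hle⟩ := hn n
    have hxa : |x| ≤ a := abs_le'.2 ⟨ha.2.1, ha.2.2.1⟩
    have hφm : |φ| ≤ m := abs_le'.2 ⟨hm.2.1, hm.2.2.1⟩
    refine (hw.2.2.2 _ (Set.mem_univ _) (inf_le_left.trans hxa) ?_).trans hle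
    exact inf_le_right.trans (nsmul_le_nsmul_right hφm n)
  · rintro ⟨z, hz, h⟩
    refine ⟨Set.mem_univ _, z, Set.mem_univ _, hz, fun x _ => ?_⟩
    obtain ⟨c, hc, hn⟩ := h x
    exact ⟨c, hc, fun n => ⟨_, _, _, hmod x, hmod φ, hinf _ _, hn n⟩⟩

end VectorLattice

/-! ### Products and powers in an algebra without unit -/

section Products

variable {A : Type*} [NonUnitalRing A]

/-- The product `g₁ ⋯ g_p` of `p ≥ 1` elements, in this order. (The empty product, which has no
meaning without a unit, gets the value `0`; it is not used.) -/
def prod : (p : ℕ) → (Fin p → A) → A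
  | 0, _ => 0
  | 1, g => g 0
  | n + 2, g => prod (n + 1) (fun i => g i.castSucc) * g (Fin.last (n + 1))

/-- The power `a ^ p` for `p ≥ 1`. -/
def power (a : A) (p : ℕ) : A := prod p (fun _ => a)

variable (A) in
/-- The set `Π_p(A)` of all `p`-fold products. -/
def productAlgebra (p : ℕ) : Set A := Set.range (fun g : Fin p → A => prod p g)

variable (A) in
/-- `0` is the only nilpotent element. -/
def IsSemiprime : Prop := ∀ a : A, (∃ n : ℕ, 1 ≤ n ∧ power a n = 0) → a = 0

end Products

/-! ### `f`-algebras -/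

section FAlg

variable (A : Type*) [NonUnitalRing A] [Lattice A]

/-- The two order conditions on the multiplication of an `f`-algebra. -/
structure IsFAlgebra : Prop where
  mul_nonneg : ∀ a b : A, 0 ≤ a → 0 ≤ b → 0 ≤ a * b
  mul_inf_eq_zero : ∀ a b c : A, a ⊓ b = 0 → 0 ≤ c → (a * c) ⊓ b = 0 ∧ (c * a) ⊓ b = 0

/-- Every element lies below a product of two elements. -/
def HasWeakFactorization : Prop := ∀ a : A, ∃ b c : A, a ≤ b * c

end FAlg

end FAlgebra

set_option linter.unusedSectionVars false

namespace FAlgebra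

section VectorLatticeBasics

variable {V : Type*} [AddCommGroup V] [Lattice V] [IsOrderedAddMonoid V]

theorem inf_add_le_add_inf {a b c : V} (ha : 0 ≤ a) (hb : 0 ≤ b) (hc : 0 ≤ c) :
    a ⊓ (b + c) ≤ a ⊓ b + a ⊓ c := by
  rw [add_inf, inf_add, inf_add]
  refine le_inf (le_inf ?_ ?_) (le_inf ?_ inf_le_right)
  · exact inf_le_left.trans (le_add_of_nonneg_right ha)
  · exact inf_le_left.trans (le_add_of_nonneg_left hb)
  · exact inf_le_left.trans (le_add_of_nonneg_right hc)

theorem inf_eq_zero_mono {a b a' b' : V} (h : a ⊓ b = 0) (ha' : 0 ≤ a') (hb' : 0 ≤ b')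
    (ha : a' ≤ a) (hb : b' ≤ b) : a' ⊓ b' = 0 :=
  le_antisymm ((inf_le_inf ha hb).trans h.le) (le_inf ha' hb')

theorem inf_add_eq_zero {a b c : V} (hab : a ⊓ b = 0) (hac : a ⊓ c = 0) : a ⊓ (b + c) = 0 := by
  have ha : 0 ≤ a := hab ▸ inf_le_left
  have hb : 0 ≤ b := hab ▸ inf_le_right
  have hc : 0 ≤ c := hac ▸ inf_le_right
  refine le_antisymm ((inf_add_le_add_inf ha hb hc).trans ?_) (le_inf ha (add_nonneg hb hc))
  rw [hab, hac, add_zero]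

theorem posPart_add_le (a b : V) : (a + b)⁺ ≤ a⁺ + b⁺ :=
  sup_le (add_le_add (le_posPart a) (le_posPart b)) (add_nonneg (posPart_nonneg a) (posPart_nonneg b))

theorem posPart_sup (a b : V) : (a ⊔ b)⁺ = a⁺ ⊔ b⁺ := posPart_max a b

variable [Module ℝ V] [IsOrderedModule ℝ V]

theorem abs_smul_le_lattice (c : ℝ) (x : V) : |c • x| ≤ |c| • |x| := by
  have key : ∀ d : ℝ, ∀ y : V, d • y ≤ |d| • |y| := by
    intro d y
    rcases le_total 0 d with h | h
    · rw [abs_of_nonneg h]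
      exact smul_le_smul_of_nonneg_left (le_abs_self y) h
    · rw [abs_of_nonpos h, ← neg_smul_neg]
      exact smul_le_smul_of_nonneg_left (neg_le_abs y) (neg_nonneg.2 h)
  refine abs_le'.2 ⟨key c x, ?_⟩
  rw [← neg_smul]
  simpa using key (-c) x

theorem abs_smul_lattice (c : ℝ) (x : V) : |c • x| = |c| • |x| := by
  refine le_antisymm (abs_smul_le_lattice c x) ?_
  rcases eq_or_ne c 0 with rfl | hc
  · simp
  have h := abs_smul_le_lattice c⁻¹ (c • x)
  rw [inv_smul_smul₀ hc] at h
  have h2 := smul_le_smul_of_nonneg_left h (abs_nonneg c)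
  rwa [smul_smul, ← abs_mul, mul_inv_cancel₀ hc, abs_one, one_smul] at h2

theorem smul_inf_lattice {c : ℝ} (hc : 0 < c) (a b : V) : c • (a ⊓ b) = c • a ⊓ c • b :=
  (OrderIso.smulRight hc).map_inf a b

theorem inf_smul_eq_zero {a b : V} (h : a ⊓ b = 0) {c d : ℝ} (hc : 0 ≤ c) (hd : 0 ≤ d) :
    c • a ⊓ d • b = 0 := by
  have ha : 0 ≤ a := h ▸ inf_le_left
  have hb : 0 ≤ b := h ▸ inf_le_right
  have hK : 0 < c + d + 1 := by positivity
  have h2 : (c + d + 1) • a ⊓ (c + d + 1) • b = 0 := by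
    rw [← smul_inf_lattice hK, h, smul_zero]
  exact inf_eq_zero_mono h2 (smul_nonneg hc ha) (smul_nonneg hd hb)
    (smul_le_smul_of_nonneg_right (by linarith) ha) (smul_le_smul_of_nonneg_right (by linarith) hb)

/-! ### Solid subspaces -/

/-- The solid subspace generated by a solid subspace `J` and a further element `a`. -/
def solidSpan (J : Submodule ℝ V) (a : V) : Submodule ℝ V where
  carrier := {x | ∃ j ∈ J, ∃ c : ℝ, |x| ≤ j + c • a}
  zero_mem' := ⟨0, J.zero_mem, 0, by simp⟩
  add_mem' := by
    rintro x y ⟨j, hj, c, hx⟩ ⟨k, hk, d, hy⟩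
    refine ⟨j + k, J.add_mem hj hk, c + d, (abs_add_le x y).trans ((add_le_add hx hy).trans ?_)⟩
    exact le_of_eq (by module)
  smul_mem' := by
    rintro t x ⟨j, hj, c, hx⟩
    refine ⟨|t| • j, J.smul_mem _ hj, |t| * c, ?_⟩
    rw [abs_smul_lattice]
    refine (smul_le_smul_of_nonneg_left hx (abs_nonneg t)).trans (le_of_eq ?_)
    module

/-- The principal ideal generated by `u`. -/
def principalIdeal (u : V) : Submodule ℝ V := solidSpan ⊥ u

theorem mem_principalIdeal {u x : V} : x ∈ principalIdeal u ↔ ∃ c : ℝ, |x| ≤ c • u := by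
  constructor
  · rintro ⟨j, hj, c, h⟩
    rw [(Submodule.mem_bot ℝ).1 hj, zero_add] at h
    exact ⟨c, h⟩
  · rintro ⟨c, h⟩
    exact ⟨0, Submodule.zero_mem _, c, by rwa [zero_add]⟩

theorem isSolid_solidSpan (J : Submodule ℝ V) (a : V) :
    LatticeOrderedAddCommGroup.IsSolid (solidSpan J a : Set V) := by
  rintro x ⟨j, hj, c, hx⟩ y hy
  exact ⟨j, hj, c, hy.trans hx⟩

theorem isSolid_principalIdeal (u : V) :
    LatticeOrderedAddCommGroup.IsSolid (principalIdeal u : Set V) := isSolid_solidSpan ⊥ u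

theorem mem_principalIdeal_of_le {u x : V} (h0 : 0 ≤ x) (h : x ≤ u) : x ∈ principalIdeal u :=
  mem_principalIdeal.2 ⟨1, by rwa [abs_of_nonneg h0, one_smul]⟩

theorem abs_mem_principalIdeal {u x : V} (h : x ∈ principalIdeal u) : |x| ∈ principalIdeal u :=
  isSolid_principalIdeal u h (abs_abs x).le

/-- A prime solid subspace that does not contain `u ≥ 0`. -/
structure IsPrimeAvoiding (J : Submodule ℝ V) (u : V) : Prop where
  nonneg : 0 ≤ u
  solid : LatticeOrderedAddCommGroup.IsSolid (J : Set V)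
  prime : ∀ a b : V, a ⊓ b = 0 → a ∈ J ∨ b ∈ J
  notMem : u ∉ J

open LatticeOrderedAddCommGroup in
theorem exists_isPrimeAvoiding {u v : V} (hu : 0 ≤ u) (hv : 0 ≤ v) (h : u ∉ principalIdeal v) :
    ∃ J : Submodule ℝ V, IsPrimeAvoiding J u ∧ v ∈ J := by
  let S : Set (Submodule ℝ V) := {J | IsSolid (J : Set V) ∧ u ∉ J}
  obtain ⟨J, hvJ, hmax⟩ := zorn_le_nonempty₀ S (by
    intro c hc hchain y hy
    have hdir : DirectedOn (· ≤ ·) c := hchain.directedOn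
    refine ⟨sSup c, ⟨?_, ?_⟩, fun z hz => le_sSup hz⟩
    · intro x hx w hw
      obtain ⟨K, hK, hxK⟩ := (Submodule.mem_sSup_of_directed ⟨y, hy⟩ hdir).1 hx
      exact (Submodule.mem_sSup_of_directed ⟨y, hy⟩ hdir).2 ⟨K, hK, (hc hK).1 hxK hw⟩
    · intro hx
      obtain ⟨K, hK, hxK⟩ := (Submodule.mem_sSup_of_directed ⟨y, hy⟩ hdir).1 hx
      exact (hc hK).2 hxK) (principalIdeal v) ⟨isSolid_principalIdeal v, h⟩
  have hJs : IsSolid (J : Set V) := hmax.prop.1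
  have habs : ∀ x ∈ J, |x| ∈ J := fun x hx => hJs hx (abs_abs x).le
  have key : ∀ a : V, 0 ≤ a → a ∉ J → ∃ j ∈ J, ∃ c : ℝ, 0 ≤ j ∧ 0 ≤ c ∧ u ≤ j + c • a := by
    intro a ha haJ
    by_contra hno
    refine haJ (hmax.le_of_ge (y := solidSpan J a) ⟨isSolid_solidSpan J a, ?_⟩ ?_ ?_)
    · rintro ⟨j, hj, c, hle⟩
      refine hno ⟨|j|, habs j hj, |c|, abs_nonneg j, abs_nonneg c, ?_⟩
      exact (le_abs_self u).trans (hle.trans (add_le_add (le_abs_self j)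
        (smul_le_smul_of_nonneg_right (le_abs_self c) ha)))
    · intro x hx
      exact ⟨|x|, habs x hx, 0, by simp⟩
    · exact ⟨0, J.zero_mem, 1, by simp [abs_of_nonneg ha]⟩
  refine ⟨J, ⟨hu, hJs, ?_, hmax.prop.2⟩, hvJ (mem_principalIdeal_of_le hv le_rfl)⟩
  intro a b hab
  by_contra hno
  rw [not_or] at hno
  have ha : 0 ≤ a := hab ▸ inf_le_left
  have hb : 0 ≤ b := hab ▸ inf_le_right
  obtain ⟨j, hj, c, hj0, hc0, h1⟩ := key a ha hno.1
  obtain ⟨k, hk, d, hk0, hd0, h2⟩ := key b hb hno.2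
  have h3 : u ≤ (j + k) + (c • a ⊓ d • b) := by
    rw [add_inf]
    refine le_inf (h1.trans ?_) (h2.trans ?_)
    · exact add_le_add_left (le_add_of_nonneg_right hk0) _
    · exact add_le_add_left (le_add_of_nonneg_left hj0) _
  rw [inf_smul_eq_zero hab hc0 hd0, add_zero] at h3
  refine hmax.prop.2 (hJs (J.add_mem hj hk) ?_)
  rwa [abs_of_nonneg hu, abs_of_nonneg (add_nonneg hj0 hk0)]

end VectorLatticeBasics

section Characters

variable {V : Type*} [AddCommGroup V] [Lattice V] [IsOrderedAddMonoid V] [Module ℝ V]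
  [IsOrderedModule ℝ V]

/-- The real number `t` is the value of `x` modulo `J`, measured in the unit `u`. -/
def IsValue (J : Submodule ℝ V) (u x : V) (t : ℝ) : Prop :=
  (∀ s, t < s → (x - s • u)⁺ ∈ J) ∧ ∀ s, s < t → (s • u - x)⁺ ∈ J

namespace IsPrimeAvoiding

variable {J : Submodule ℝ V} {u : V}

theorem mem_of_le (hJ : IsPrimeAvoiding J u) {x y : V} (hy : y ∈ J) (h0 : 0 ≤ x) (h : x ≤ y) :
    x ∈ J :=
  hJ.solid hy (by rwa [abs_of_nonneg h0, abs_of_nonneg (h0.trans h)])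

theorem not_smul_le (hJ : IsPrimeAvoiding J u) {c : ℝ} (hc : 0 < c) {y : V} (hy : y ∈ J) :
    ¬ c • u ≤ y := fun h =>
  hJ.notMem ((Submodule.smul_mem_iff J hc.ne').1 (hJ.mem_of_le hy (smul_nonneg hc.le hJ.nonneg) h))

theorem not_lt_of_mem (hJ : IsPrimeAvoiding J u) {x : V} {s t : ℝ} (h1 : (x - s • u)⁺ ∈ J)
    (h2 : (t • u - x)⁺ ∈ J) : t ≤ s := by
  by_contra! hlt
  refine hJ.not_smul_le (sub_pos.2 hlt) (J.add_mem h1 h2) ?_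
  calc (t - s) • u = (x - s • u) + (t • u - x) := by module
    _ ≤ _ := add_le_add (le_posPart _) (le_posPart _)

theorem isValue_unique (hJ : IsPrimeAvoiding J u) {x : V} {s t : ℝ} (hs : IsValue J u x s)
    (ht : IsValue J u x t) : s = t := by
  have key : ∀ s t : ℝ, IsValue J u x s → IsValue J u x t → ¬ s < t := by
    intro s t hs ht hlt
    obtain ⟨m, h1, h2⟩ := exists_between hlt
    obtain ⟨k, h3, h4⟩ := exists_between h2
    exact absurd h3 (not_lt.2 (hJ.not_lt_of_mem (hs.1 m h1) (ht.2 k h4)))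
  exact le_antisymm (not_lt.1 (key _ _ ht hs)) (not_lt.1 (key _ _ hs ht))

theorem exists_isValue (hJ : IsPrimeAvoiding J u) {x : V} (hx : x ∈ principalIdeal u) :
    ∃ t, IsValue J u x t := by
  obtain ⟨c, hc⟩ := mem_principalIdeal.1 hx
  let S : Set ℝ := {s | (x - s • u)⁺ ∈ J}
  have hup : ∀ s ∈ S, ∀ t, s ≤ t → t ∈ S := by
    intro s hs t hst
    refine hJ.mem_of_le (y := (x - s • u)⁺) hs (posPart_nonneg _) (posPart_mono ?_)
    exact sub_le_sub_left (smul_le_smul_of_nonneg_right hst hJ.nonneg) x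
  have hmem : c ∈ S := by
    have : (x - c • u)⁺ = 0 := posPart_eq_zero.2 (sub_nonpos.2 ((le_abs_self x).trans hc))
    simp [S, this]
  have hbot : (-c) • u ≤ x := by
    rw [neg_smul, neg_le]
    exact (neg_le_abs x).trans hc
  have hbdd : BddBelow S := by
    refine ⟨-c, fun s hs => hJ.not_lt_of_mem hs ?_⟩
    rw [posPart_eq_zero.2 (sub_nonpos.2 hbot)]
    exact J.zero_mem
  refine ⟨sInf S, fun s hs => ?_, fun s hs => ?_⟩
  · obtain ⟨r, hr, hrs⟩ := exists_lt_of_csInf_lt ⟨c, hmem⟩ hs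
    exact hup r hr s hrs.le
  · have h1 : s ∉ S := fun h => absurd (csInf_le hbdd h) (not_le.2 hs)
    have h2 := (hJ.prime _ _ (posPart_inf_negPart_eq_zero (x - s • u))).resolve_left h1
    rwa [← posPart_neg, neg_sub] at h2

end IsPrimeAvoiding

namespace IsValue

variable {J : Submodule ℝ V} {u x y : V} {s t : ℝ}

theorem add (hJ : IsPrimeAvoiding J u) (hx : IsValue J u x s) (hy : IsValue J u y t) :
    IsValue J u (x + y) (s + t) := by
  constructor
  · intro r hr
    have h := J.add_mem (hx.1 (s + (r - (s + t)) / 2) (by linarith))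
      (hy.1 (t + (r - (s + t)) / 2) (by linarith))
    refine hJ.mem_of_le h (posPart_nonneg _) (le_trans (le_of_eq ?_) (posPart_add_le _ _))
    congr 1
    module
  · intro r hr
    have h := J.add_mem (hx.2 (s + (r - (s + t)) / 2) (by linarith))
      (hy.2 (t + (r - (s + t)) / 2) (by linarith))
    refine hJ.mem_of_le h (posPart_nonneg _) (le_trans (le_of_eq ?_) (posPart_add_le _ _))
    congr 1
    module

theorem neg (hx : IsValue J u x s) : IsValue J u (-x) (-s) := by
  constructor
  · intro r hr
    have h := hx.2 (-r) (by linarith)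
    rwa [show -r • u - x = -x - r • u by module] at h
  · intro r hr
    have h := hx.1 (-r) (by linarith)
    rwa [show x - -r • u = r • u - -x by module] at h

theorem zero (hJ : IsPrimeAvoiding J u) : IsValue J u 0 0 := by
  constructor
  · intro r hr
    rw [posPart_eq_zero.2 (by simpa using smul_nonneg hr.le hJ.nonneg)]
    exact J.zero_mem
  · intro r hr
    rw [posPart_eq_zero.2 (by simpa using smul_nonpos_of_nonpos_of_nonneg hr.le hJ.nonneg)]
    exact J.zero_mem

theorem unit (hJ : IsPrimeAvoiding J u) : IsValue J u u 1 := by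
  constructor
  · intro r hr
    have : u - r • u ≤ 0 := by
      rw [show u - r • u = -((r - 1) • u) by module]
      exact neg_nonpos.2 (smul_nonneg (by linarith) hJ.nonneg)
    rw [posPart_eq_zero.2 this]
    exact J.zero_mem
  · intro r hr
    have : r • u - u ≤ 0 := by
      rw [show r • u - u = -((1 - r) • u) by module]
      exact neg_nonpos.2 (smul_nonneg (by linarith) hJ.nonneg)
    rw [posPart_eq_zero.2 this]
    exact J.zero_mem

theorem smul_pos (hJ : IsPrimeAvoiding J u) (hx : IsValue J u x s) {c : ℝ} (hc : 0 < c) :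
    IsValue J u (c • x) (c * s) := by
  have hpos : ∀ w : V, w⁺ ∈ J → (c • w)⁺ ∈ J := fun w hw =>
    hJ.mem_of_le (J.smul_mem c hw) (posPart_nonneg _)
      (sup_le (smul_le_smul_of_nonneg_left (le_posPart w) hc.le)
        (smul_nonneg hc.le (posPart_nonneg w)))
  constructor
  · intro r hr
    have h := hpos _ (hx.1 (r / c) (by rwa [lt_div_iff₀' hc]))
    rwa [smul_sub, smul_smul, mul_div_cancel₀ r hc.ne'] at h
  · intro r hr
    have h := hpos _ (hx.2 (r / c) (by rwa [div_lt_iff₀' hc]))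
    rwa [smul_sub, smul_smul, mul_div_cancel₀ r hc.ne'] at h

theorem smul (hJ : IsPrimeAvoiding J u) (hx : IsValue J u x s) (c : ℝ) :
    IsValue J u (c • x) (c * s) := by
  rcases lt_trichotomy c 0 with hc | rfl | hc
  · simpa using (hx.smul_pos hJ (neg_pos.2 hc)).neg
  · simpa using zero hJ
  · exact hx.smul_pos hJ hc

theorem sup (hJ : IsPrimeAvoiding J u) (hx : IsValue J u x s) (hy : IsValue J u y t) :
    IsValue J u (x ⊔ y) (s ⊔ t) := by
  constructor
  · intro r hr
    rw [sup_lt_iff] at hr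
    refine hJ.mem_of_le (J.add_mem (hx.1 r hr.1) (hy.1 r hr.2)) (posPart_nonneg _) ?_
    rw [sup_sub, posPart_sup]
    exact sup_le (le_add_of_nonneg_right (posPart_nonneg _))
      (le_add_of_nonneg_left (posPart_nonneg _))
  · intro r hr
    rcases lt_sup_iff.1 hr with h | h
    · exact hJ.mem_of_le (hx.2 r h) (posPart_nonneg _)
        (posPart_mono (sub_le_sub_left le_sup_left _))
    · exact hJ.mem_of_le (hy.2 r h) (posPart_nonneg _)
        (posPart_mono (sub_le_sub_left le_sup_right _))

theorem abs (hJ : IsPrimeAvoiding J u) (hx : IsValue J u x s) : IsValue J u |x| |s| :=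
  hx.sup hJ hx.neg

end IsValue

/-- A linear functional that is a lattice homomorphism on the ideal generated by `u` and takes
the value `1` at `u`. -/
structure IsCharacter (u : V) (ω : V →ₗ[ℝ] ℝ) : Prop where
  map_unit : ω u = 1
  map_abs : ∀ x ∈ principalIdeal u, ω |x| = |ω x|

theorem IsPrimeAvoiding.exists_isCharacter {J : Submodule ℝ V} {u : V}
    (hJ : IsPrimeAvoiding J u) :
    ∃ ω : V →ₗ[ℝ] ℝ, IsCharacter u ω ∧ ∀ x ∈ principalIdeal u, IsValue J u x (ω x) := by
  choose f hf using fun x : principalIdeal u => hJ.exists_isValue x.2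
  let φ : principalIdeal u →ₗ[ℝ] ℝ :=
    { toFun := f
      map_add' := fun x y => hJ.isValue_unique (hf (x + y)) ((hf x).add hJ (hf y))
      map_smul' := fun c x => hJ.isValue_unique (hf (c • x)) ((hf x).smul hJ c) }
  obtain ⟨ω, hω⟩ := φ.exists_extend
  have hval : ∀ x ∈ principalIdeal u, IsValue J u x (ω x) := by
    intro x hx
    have h : ω x = f ⟨x, hx⟩ := LinearMap.congr_fun hω ⟨x, hx⟩
    rw [h]
    exact hf ⟨x, hx⟩
  refine ⟨ω, ⟨?_, fun x hx => ?_⟩, hval⟩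
  · exact hJ.isValue_unique (hval u (mem_principalIdeal_of_le hJ.nonneg le_rfl)) (.unit hJ)
  · exact hJ.isValue_unique (hval _ (abs_mem_principalIdeal hx)) ((hval x hx).abs hJ)

namespace IsCharacter

variable {u : V} {ω : V →ₗ[ℝ] ℝ}

theorem nonneg (hω : IsCharacter u ω) {x : V} (hx : x ∈ principalIdeal u) (h : 0 ≤ x) :
    0 ≤ ω x := by
  rw [← abs_of_nonneg h, hω.map_abs x hx]
  exact abs_nonneg _

theorem mono (hω : IsCharacter u ω) {x y : V} (hx : x ∈ principalIdeal u)
    (hy : y ∈ principalIdeal u) (h : x ≤ y) : ω x ≤ ω y := by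
  have := hω.nonneg (Submodule.sub_mem _ hy hx) (sub_nonneg.2 h)
  rw [map_sub] at this
  linarith

theorem map_negPart (hω : IsCharacter u ω) {x : V} (hx : x ∈ principalIdeal u) :
    ω x⁻ = (ω x)⁻ := by
  have h1 : ω |x| = ω x⁺ + ω x⁻ := by rw [← posPart_add_negPart, map_add]
  have h2 : ω x = ω x⁺ - ω x⁻ := by rw [← map_sub, posPart_sub_negPart]
  have h3 := posPart_add_negPart (ω x)
  have h4 := posPart_sub_negPart (ω x)
  rw [hω.map_abs x hx] at h1
  linarith

theorem map_posPart (hω : IsCharacter u ω) {x : V} (hx : x ∈ principalIdeal u) :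
    ω x⁺ = (ω x)⁺ := by
  have h := hω.map_negPart ((principalIdeal u).neg_mem hx)
  rwa [negPart_neg, map_neg, negPart_neg] at h

theorem map_sup (hω : IsCharacter u ω) {x y : V} (hx : x ∈ principalIdeal u)
    (hy : y ∈ principalIdeal u) : ω (x ⊔ y) = ω x ⊔ ω y := by
  rw [sup_eq_add_posPart_sub, sup_eq_add_posPart_sub (ω x), map_add,
    hω.map_posPart (Submodule.sub_mem _ hx hy), map_sub]

theorem map_inf (hω : IsCharacter u ω) {x y : V} (hx : x ∈ principalIdeal u)
    (hy : y ∈ principalIdeal u) : ω (x ⊓ y) = ω x ⊓ ω y := by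
  rw [inf_eq_sub_posPart_sub, inf_eq_sub_posPart_sub (ω x), map_sub,
    hω.map_posPart (Submodule.sub_mem _ hx hy), map_sub]

end IsCharacter

theorem IsArchimedean.exists_isCharacter_pos (harch : IsArchimedean V) {u y : V} (hu : 0 ≤ u)
    (hy : y ∈ principalIdeal u) (hy0 : 0 ≤ y) (hne : y ≠ 0) :
    ∃ ω : V →ₗ[ℝ] ℝ, IsCharacter u ω ∧ 0 < ω y := by
  obtain ⟨n, hn⟩ : ∃ n : ℕ, ¬ n • y ≤ u := by
    by_contra! h
    exact hne (harch y u hy0 hu h)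
  have hnpos : 0 < n := by
    rcases Nat.eq_zero_or_pos n with rfl | h
    · simp [hu] at hn
    · exact h
  have hn0 : (0 : ℝ) < n := by exact_mod_cast hnpos
  rw [← Nat.cast_smul_eq_nsmul ℝ] at hn
  set d := (n : ℝ) • y - u with hd
  have hw : d⁺ ≠ 0 := fun h => hn (sub_nonpos.1 (posPart_eq_zero.1 h))
  have hv : u ∉ principalIdeal d⁻ := by
    intro h
    obtain ⟨k, hk⟩ := mem_principalIdeal.1 h
    obtain ⟨c, hc⟩ := mem_principalIdeal.1 hy
    have h0 := negPart_nonneg d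
    have h1 : u ≤ |k| • d⁻ := (le_abs_self u).trans
      (hk.trans (smul_le_smul_of_nonneg_right (le_abs_self k) h0))
    have h2 : y ≤ |c| • u := (le_abs_self y).trans
      (hc.trans (smul_le_smul_of_nonneg_right (le_abs_self c) hu))
    have h3 : d⁺ ≤ (n : ℝ) • y := sup_le (sub_le_self _ hu) (smul_nonneg hn0.le hy0)
    have h4 : d⁺ ≤ ((n : ℝ) * |c| * |k|) • d⁻ := by
      refine h3.trans ?_
      rw [mul_assoc, mul_smul, mul_smul]
      refine smul_le_smul_of_nonneg_left (h2.trans ?_) hn0.le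
      exact smul_le_smul_of_nonneg_left h1 (abs_nonneg c)
    have h5 := inf_smul_eq_zero (posPart_inf_negPart_eq_zero d) (zero_le_one (α := ℝ))
      (show 0 ≤ (n : ℝ) * |c| * |k| by positivity)
    rw [one_smul, inf_eq_left.2 h4] at h5
    exact hw h5
  obtain ⟨J, hJ, hvJ⟩ := exists_isPrimeAvoiding hu (negPart_nonneg d) hv
  obtain ⟨ω, hω, hval⟩ := hJ.exists_isCharacter
  refine ⟨ω, hω, ?_⟩
  by_contra! hle
  have h1 := (hval y hy).1 ((n : ℝ)⁻¹ / 2) (lt_of_le_of_lt hle (by positivity))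
  refine hJ.not_smul_le (c := 1 / 2) (by norm_num) (J.add_mem hvJ (J.smul_mem (n : ℝ) h1)) ?_
  calc (1 / 2 : ℝ) • u = -d + (n : ℝ) • (y - ((n : ℝ)⁻¹ / 2) • u) := by
        rw [hd, smul_sub, smul_smul, mul_div_assoc', mul_inv_cancel₀ hn0.ne']
        module
    _ ≤ _ := add_le_add (neg_le_negPart d) (smul_le_smul_of_nonneg_left (le_posPart _) hn0.le)

theorem IsArchimedean.nonneg_of_isCharacter (harch : IsArchimedean V) {u x : V} (hu : 0 ≤ u)
    (hx : x ∈ principalIdeal u) (h : ∀ ω : V →ₗ[ℝ] ℝ, IsCharacter u ω → 0 ≤ ω x) : 0 ≤ x := by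
  rw [← negPart_eq_zero]
  by_contra hne
  have hmem : x⁻ ∈ principalIdeal u := by
    refine isSolid_principalIdeal u hx ?_
    rw [abs_of_nonneg (negPart_nonneg x), ← posPart_add_negPart]
    exact le_add_of_nonneg_left (posPart_nonneg x)
  obtain ⟨ω, hω, hpos⟩ := harch.exists_isCharacter_pos hu hmem (negPart_nonneg x) hne
  rw [hω.map_negPart hx, negPart_eq_zero.2 (h ω hω)] at hpos
  exact lt_irrefl _ hpos

theorem IsArchimedean.le_of_isCharacter (harch : IsArchimedean V) {u x y : V} (hu : 0 ≤ u)
    (hx : x ∈ principalIdeal u) (hy : y ∈ principalIdeal u)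
    (h : ∀ ω : V →ₗ[ℝ] ℝ, IsCharacter u ω → ω x ≤ ω y) : x ≤ y := by
  rw [← sub_nonneg]
  refine harch.nonneg_of_isCharacter hu (Submodule.sub_mem _ hy hx) fun ω hω => ?_
  rw [map_sub, sub_nonneg]
  exact h ω hω

theorem IsArchimedean.eq_of_isCharacter (harch : IsArchimedean V) {u x y : V} (hu : 0 ≤ u)
    (hx : x ∈ principalIdeal u) (hy : y ∈ principalIdeal u)
    (h : ∀ ω : V →ₗ[ℝ] ℝ, IsCharacter u ω → ω x = ω y) : x = y :=
  le_antisymm (harch.le_of_isCharacter hu hx hy fun ω hω => (h ω hω).le)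
    (harch.le_of_isCharacter hu hy hx fun ω hω => (h ω hω).ge)

end Characters

section FunctionalCalculus

variable {V : Type*} [AddCommGroup V] [Lattice V] [IsOrderedAddMonoid V] [Module ℝ V]
  [IsOrderedModule ℝ V]

/-- `a` represents the function `F` of the elements `g i` of the order interval `[0, e]`. -/
def Represents {ι : Type*} (e : V) (g : ι → V) (F : C(ι → Set.Icc (0 : ℝ) 1, ℝ)) (a : V) : Prop :=
  a ∈ principalIdeal e ∧ ∀ ω : V →ₗ[ℝ] ℝ, IsCharacter e ω →
    ∀ t : ι → Set.Icc (0 : ℝ) 1, (∀ i, (t i : ℝ) = ω (g i)) → ω a = F t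

theorem IsCharacter.exists_point {ι : Type*} {e : V} {g : ι → V} (hg0 : ∀ i, 0 ≤ g i)
    (hge : ∀ i, g i ≤ e) {ω : V →ₗ[ℝ] ℝ} (hω : IsCharacter e ω) :
    ∃ t : ι → Set.Icc (0 : ℝ) 1, ∀ i, (t i : ℝ) = ω (g i) := by
  have hmem := fun i => mem_principalIdeal_of_le (hg0 i) (hge i)
  refine ⟨fun i => ⟨ω (g i), hω.nonneg (hmem i) (hg0 i), ?_⟩, fun i => rfl⟩
  rw [← hω.map_unit]
  exact hω.mono (hmem i) (mem_principalIdeal_of_le ((hg0 i).trans (hge i)) le_rfl) (hge i)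

theorem Represents.of_mem_closure {ι : Type*} [Fintype ι] (harch : IsArchimedean V)
    (huc : IsUniformlyComplete V) {e : V} (he : 0 ≤ e) {g : ι → V} (hg0 : ∀ i, 0 ≤ g i)
    (hge : ∀ i, g i ≤ e) {F : C(ι → Set.Icc (0 : ℝ) 1, ℝ)}
    (hF : F ∈ closure {F | ∃ a, Represents e g F a}) : ∃ a, Represents e g F a := by
  have hee : e ∈ principalIdeal e := mem_principalIdeal_of_le he le_rfl
  have happ : ∀ n : ℕ, ∃ G : C(ι → Set.Icc (0 : ℝ) 1, ℝ), (∃ a, Represents e g G a) ∧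
      ∀ t, |F t - G t| ≤ 1 / (n + 1 : ℝ) := by
    intro n
    obtain ⟨G, hG, hd⟩ := Metric.mem_closure_iff.1 hF (1 / (n + 1 : ℝ)) Nat.one_div_pos_of_nat
    refine ⟨G, hG, fun t => ?_⟩
    rw [← Real.dist_eq]
    exact (ContinuousMap.dist_apply_le_dist t).trans hd.le
  choose G hGa hG using happ
  choose a ha using hGa
  have hval : ∀ n (ω : V →ₗ[ℝ] ℝ), IsCharacter e ω → ∀ t : ι → Set.Icc (0 : ℝ) 1,
      (∀ i, (t i : ℝ) = ω (g i)) → |F t - ω (a n)| ≤ 1 / (n + 1 : ℝ) := by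
    intro n ω hω t ht
    rw [(ha n).2 ω hω t ht]
    exact hG n t
  have hsmall : ∀ ε : ℝ, 0 < ε → ∃ N : ℕ, ∀ n ≥ N, 1 / (n + 1 : ℝ) ≤ ε := by
    intro ε hε
    obtain ⟨N, hN⟩ := exists_nat_one_div_lt hε
    exact ⟨N, fun n hn => (Nat.one_div_le_one_div hn).trans hN.le⟩
  obtain ⟨l, hl⟩ := huc e he a (by
    intro ε hε
    obtain ⟨N, hN⟩ := hsmall (ε / 2) (half_pos hε)
    refine ⟨N, fun m hm n hn => ?_⟩
    have hmn : a m - a n ∈ principalIdeal e := Submodule.sub_mem _ (ha m).1 (ha n).1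
    refine harch.le_of_isCharacter he (abs_mem_principalIdeal hmn) (Submodule.smul_mem _ _ hee)
      fun ω hω => ?_
    obtain ⟨t, ht⟩ := hω.exists_point hg0 hge
    rw [hω.map_abs _ hmn, map_sub, map_smul, hω.map_unit, smul_eq_mul, mul_one]
    have h1 := abs_le.1 ((hval m ω hω t ht).trans (hN m hm))
    have h2 := abs_le.1 ((hval n ω hω t ht).trans (hN n hn))
    exact abs_le.2 ⟨by linarith [h1.1, h2.2], by linarith [h1.2, h2.1]⟩)
  have hlmem : ∀ n, a n - l ∈ principalIdeal e → l ∈ principalIdeal e := fun n h => by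
    simpa using Submodule.sub_mem _ (ha n).1 h
  have hle : l ∈ principalIdeal e := by
    obtain ⟨N, hN⟩ := hl 1 one_pos
    exact hlmem N (mem_principalIdeal.2 ⟨1, hN N le_rfl⟩)
  refine ⟨l, hle, fun ω hω t ht => ?_⟩
  refine eq_of_forall_dist_le fun ε hε => ?_
  obtain ⟨N, hN⟩ := hl (ε / 2) (half_pos hε)
  obtain ⟨M, hM⟩ := hsmall (ε / 2) (half_pos hε)
  have hmem : a (max N M) - l ∈ principalIdeal e := Submodule.sub_mem _ (ha _).1 hle
  have h1 := hω.mono (abs_mem_principalIdeal hmem) (Submodule.smul_mem _ _ hee)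
    (hN (max N M) (le_max_left _ _))
  rw [hω.map_abs _ hmem, map_sub, map_smul, hω.map_unit, smul_eq_mul, mul_one] at h1
  have h2 := abs_le.1 ((hval (max N M) ω hω t ht).trans (hM _ (le_max_right _ _)))
  rw [Real.dist_eq]
  have h3 := abs_le.1 h1
  exact abs_le.2 ⟨by linarith [h3.2, h2.1], by linarith [h3.1, h2.2]⟩

/-- Continuous functional calculus in a uniformly complete Archimedean vector lattice. -/
theorem exists_represents {ι : Type*} [Fintype ι] (harch : IsArchimedean V)
    (huc : IsUniformlyComplete V) {e : V} (he : 0 ≤ e) {g : ι → V} (hg0 : ∀ i, 0 ≤ g i)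
    (hge : ∀ i, g i ≤ e) (F : C(ι → Set.Icc (0 : ℝ) 1, ℝ)) : ∃ a, Represents e g F a := by
  have hee : e ∈ principalIdeal e := mem_principalIdeal_of_le he le_rfl
  have hconst : ∀ c : ℝ, Represents e g (ContinuousMap.const _ c) (c • e) := fun c =>
    ⟨Submodule.smul_mem _ _ hee, fun ω hω t _ => by simp [hω.map_unit]⟩
  refine Represents.of_mem_closure harch huc he hg0 hge ?_
  rw [ContinuousMap.sublattice_closure_eq_top]
  · exact Set.mem_univ _
  · exact ⟨_, _, hconst 0⟩
  · rintro F ⟨a, ha⟩ G ⟨b, hb⟩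
    refine ⟨a ⊓ b, ?_, fun ω hω t ht => ?_⟩
    · rw [inf_eq_sub_posPart_sub]
      refine Submodule.sub_mem _ ha.1 (isSolid_principalIdeal e (Submodule.sub_mem _ ha.1 hb.1) ?_)
      rw [abs_of_nonneg (posPart_nonneg _), ← posPart_add_negPart]
      exact le_add_of_nonneg_right (negPart_nonneg _)
    · rw [hω.map_inf ha.1 hb.1, ha.2 ω hω t ht, hb.2 ω hω t ht, ContinuousMap.inf_apply]
  · rintro F ⟨a, ha⟩ G ⟨b, hb⟩
    refine ⟨a ⊔ b, ?_, fun ω hω t ht => ?_⟩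
    · rw [sup_eq_add_posPart_sub]
      refine Submodule.add_mem _ hb.1 (isSolid_principalIdeal e (Submodule.sub_mem _ ha.1 hb.1) ?_)
      rw [abs_of_nonneg (posPart_nonneg _), ← posPart_add_negPart]
      exact le_add_of_nonneg_right (negPart_nonneg _)
    · rw [hω.map_sup ha.1 hb.1, ha.2 ω hω t ht, hb.2 ω hω t ht, ContinuousMap.sup_apply]
  · intro v x y
    by_cases hxy : x = y
    · subst hxy
      exact ⟨_, ⟨_, hconst (v x)⟩, by simp⟩
    · obtain ⟨i, hi⟩ := Function.ne_iff.1 hxy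
      have hne : (y i : ℝ) - x i ≠ 0 := sub_ne_zero.2 fun h => hi (Subtype.ext h.symm)
      let d : ℝ := (v y - v x) / (y i - x i)
      refine ⟨⟨fun t => v x + d * ((t i : ℝ) - x i), by fun_prop⟩,
        ⟨(v x - d * x i) • e + d • g i, ?_, fun ω hω t ht => ?_⟩, ?_, ?_⟩
      · exact Submodule.add_mem _ (Submodule.smul_mem _ _ hee)
          (Submodule.smul_mem _ _ (mem_principalIdeal_of_le (hg0 i) (hge i)))
      · simp only [map_add, map_smul, hω.map_unit, smul_eq_mul, ContinuousMap.coe_mk, ht i]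
        ring
      · simp
      · simp only [ContinuousMap.coe_mk, d]
        field_simp
        ring

end FunctionalCalculus

section Multiplication

variable {A : Type*} [NonUnitalRing A] [Lattice A] [IsOrderedAddMonoid A]

theorem abs_sub_of_inf_eq_zero {a b : A} (h : a ⊓ b = 0) : |a - b| = a + b := by
  rw [abs_sub_comm, ← sup_sub_inf_eq_abs_sub, h, sub_zero, ← inf_add_sup a b, h, zero_add]

namespace IsFAlgebra

variable (hf : IsFAlgebra A)
include hf

theorem mul_le_mul_right {a b c : A} (h : a ≤ b) (hc : 0 ≤ c) : a * c ≤ b * c := by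
  have := hf.mul_nonneg _ _ (sub_nonneg.2 h) hc
  rwa [sub_mul, sub_nonneg] at this

theorem mul_le_mul_left {a b c : A} (h : a ≤ b) (hc : 0 ≤ c) : c * a ≤ c * b := by
  have := hf.mul_nonneg _ _ hc (sub_nonneg.2 h)
  rwa [mul_sub, sub_nonneg] at this

theorem mul_le_mul {a b c d : A} (h : a ≤ b) (h' : c ≤ d) (hc : 0 ≤ c) (hb : 0 ≤ b) :
    a * c ≤ b * d :=
  (hf.mul_le_mul_right h hc).trans (hf.mul_le_mul_left h' hb)

theorem inf_mul_right {a b c : A} (h : a ⊓ b = 0) (hc : 0 ≤ c) : a ⊓ (b * c) = 0 := by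
  rw [inf_comm] at h ⊢
  exact (hf.mul_inf_eq_zero b a c h hc).1

theorem inf_mul_left {a b c : A} (h : a ⊓ b = 0) (hc : 0 ≤ c) : a ⊓ (c * b) = 0 := by
  rw [inf_comm] at h ⊢
  exact (hf.mul_inf_eq_zero b a c h hc).2

theorem mul_eq_zero_of_inf {a b : A} (h : a ⊓ b = 0) : a * b = 0 := by
  have ha : 0 ≤ a := h ▸ inf_le_left
  have hb : 0 ≤ b := h ▸ inf_le_right
  have h1 := (hf.mul_inf_eq_zero a b b h hb).1
  have h2 := hf.inf_mul_left h1 ha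
  rwa [inf_idem] at h2

theorem abs_mul (a b : A) : |a * b| = |a| * |b| := by
  have ha := posPart_inf_negPart_eq_zero a
  have hb := posPart_inf_negPart_eq_zero b
  have ha' : a⁻ ⊓ a⁺ = 0 := by rwa [inf_comm]
  have hb' : b⁻ ⊓ b⁺ = 0 := by rwa [inf_comm]
  have pa := posPart_nonneg a
  have na := negPart_nonneg a
  have pb := posPart_nonneg b
  have nb := negPart_nonneg b
  have hdisj : (a⁺ * b⁺ + a⁻ * b⁻) ⊓ (a⁺ * b⁻ + a⁻ * b⁺) = 0 := by
    refine inf_add_eq_zero ?_ ?_ <;> rw [inf_comm] <;> refine inf_add_eq_zero ?_ ?_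
    · refine hf.inf_mul_left ?_ pa
      rw [inf_comm]
      exact hf.inf_mul_left hb pa
    · refine hf.inf_mul_right ?_ nb
      rw [inf_comm]
      exact hf.inf_mul_right ha' nb
    · refine hf.inf_mul_right ?_ pb
      rw [inf_comm]
      exact hf.inf_mul_right ha pb
    · refine hf.inf_mul_left ?_ na
      rw [inf_comm]
      exact hf.inf_mul_left hb' na
  have h1 : a * b = (a⁺ * b⁺ + a⁻ * b⁻) - (a⁺ * b⁻ + a⁻ * b⁺) := by
    conv_lhs => rw [← posPart_sub_negPart a, ← posPart_sub_negPart b]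
    noncomm_ring
  have h2 : |a| * |b| = (a⁺ * b⁺ + a⁻ * b⁻) + (a⁺ * b⁻ + a⁻ * b⁺) := by
    rw [← posPart_add_negPart a, ← posPart_add_negPart b]
    noncomm_ring
  rw [h2, h1, abs_sub_of_inf_eq_zero hdisj]

end IsFAlgebra

theorem power_one (a : A) : power a 1 = a := rfl

theorem power_succ (a : A) (n : ℕ) : power a (n + 2) = power a (n + 1) * a := rfl

theorem prod_succ (n : ℕ) (g : Fin (n + 2) → A) :
    prod (n + 2) g = prod (n + 1) (fun i => g i.castSucc) * g (Fin.last (n + 1)) := rfl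

namespace IsFAlgebra

variable (hf : IsFAlgebra A)
include hf

theorem prod_nonneg (n : ℕ) (g : Fin (n + 1) → A) (hg : ∀ i, 0 ≤ g i) : 0 ≤ prod (n + 1) g := by
  induction n with
  | zero => exact hg 0
  | succ n ih => exact hf.mul_nonneg _ _ (ih _ fun i => hg _) (hg _)

theorem prod_mono (n : ℕ) (g h : Fin (n + 1) → A) (hg : ∀ i, 0 ≤ g i) (hgh : ∀ i, g i ≤ h i) :
    prod (n + 1) g ≤ prod (n + 1) h := by
  induction n with
  | zero => exact hgh 0
  | succ n ih =>
    exact hf.mul_le_mul (ih _ _ (fun i => hg _) fun i => hgh _) (hgh _) (hg _)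
      (hf.prod_nonneg n _ fun i => (hg _).trans (hgh _))

theorem abs_prod (n : ℕ) (g : Fin (n + 1) → A) :
    |prod (n + 1) g| = prod (n + 1) fun i => |g i| := by
  induction n with
  | zero => rfl
  | succ n ih => rw [prod_succ, hf.abs_mul, ih, prod_succ]

theorem power_nonneg (n : ℕ) {a : A} (ha : 0 ≤ a) : 0 ≤ power a (n + 1) :=
  hf.prod_nonneg n _ fun _ => ha

theorem power_mono (n : ℕ) {a b : A} (ha : 0 ≤ a) (h : a ≤ b) :
    power a (n + 1) ≤ power b (n + 1) :=
  hf.prod_mono n _ _ (fun _ => ha) fun _ => h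

theorem abs_power (n : ℕ) (a : A) : |power a (n + 1)| = power |a| (n + 1) :=
  hf.abs_prod n _

theorem inf_power (n : ℕ) {a b : A} (h : a ⊓ b = 0) : a ⊓ power b (n + 1) = 0 := by
  cases n with
  | zero => exact h
  | succ n => exact hf.inf_mul_left h (hf.power_nonneg n (h ▸ inf_le_right))

theorem inf_power_sub_power (n : ℕ) {w m r : A} (hm : 0 ≤ m) (hmr : m ≤ r)
    (h : w ⊓ (r - m) = 0) : w ⊓ (power r (n + 1) - power m (n + 1)) = 0 := by
  induction n with
  | zero => exact h
  | succ n ih =>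
    have : power r (n + 2) - power m (n + 2) =
        (power r (n + 1) - power m (n + 1)) * r + power m (n + 1) * (r - m) := by
      rw [power_succ, power_succ]
      noncomm_ring
    rw [this]
    exact inf_add_eq_zero (hf.inf_mul_right ih (hm.trans hmr))
      (hf.inf_mul_left h (hf.power_nonneg n hm))

theorem power_inf (n : ℕ) {r s : A} (hr : 0 ≤ r) (hs : 0 ≤ s) :
    power (r ⊓ s) (n + 1) = power r (n + 1) ⊓ power s (n + 1) := by
  have hm : 0 ≤ r ⊓ s := le_inf hr hs
  have h0 : (s - r ⊓ s) ⊓ (r - r ⊓ s) = 0 := by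
    rw [← inf_sub, inf_comm, sub_self]
  have h1 := hf.inf_power_sub_power n hm inf_le_left h0
  rw [inf_comm] at h1
  have h2 := hf.inf_power_sub_power n hm inf_le_right h1
  rw [← inf_sub, sub_eq_zero] at h2
  exact h2.symm

theorem power_add_le (n : ℕ) {a b : A} (ha : 0 ≤ a) (hb : 0 ≤ b) :
    power a (n + 1) + power b (n + 1) ≤ power (a + b) (n + 1) := by
  induction n with
  | zero => exact le_rfl
  | succ n ih =>
    have h1 : (power a (n + 1) + power b (n + 1)) * (a + b) ≤ power (a + b) (n + 2) :=
      hf.mul_le_mul_right ih (add_nonneg ha hb)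
    refine le_trans ?_ h1
    have h2 : (power a (n + 1) + power b (n + 1)) * (a + b) =
        power a (n + 2) + power b (n + 2) + (power a (n + 1) * b + power b (n + 1) * a) := by
      rw [power_succ, power_succ]
      noncomm_ring
    rw [h2]
    exact le_add_of_nonneg_right (add_nonneg (hf.mul_nonneg _ _ (hf.power_nonneg n ha) hb)
      (hf.mul_nonneg _ _ (hf.power_nonneg n hb) ha))

theorem le_of_power_le (hs : IsSemiprime A) (n : ℕ) {a b : A} (ha : 0 ≤ a) (hb : 0 ≤ b)
    (h : power a (n + 1) ≤ power b (n + 1)) : a ≤ b := by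
  have h1 : power (a ⊓ b) (n + 1) = power a (n + 1) := by
    rw [hf.power_inf n ha hb, inf_eq_left.2 h]
  have hu : 0 ≤ a - a ⊓ b := sub_nonneg.2 inf_le_left
  have h2 := hf.power_add_le n hu (le_inf ha hb)
  rw [sub_add_cancel, h1, add_le_iff_nonpos_left] at h2
  have h3 := hs _ ⟨n + 1, Nat.le_add_left 1 n, le_antisymm h2 (hf.power_nonneg n hu)⟩
  rw [sub_eq_zero] at h3
  exact h3 ▸ inf_le_right

end IsFAlgebra

variable [Module ℝ A] [IsOrderedModule ℝ A] [IsScalarTower ℝ A A] [SMulCommClass ℝ A A]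

theorem power_smul (n : ℕ) (c : ℝ) (a : A) :
    power (c • a) (n + 1) = c ^ (n + 1) • power a (n + 1) := by
  induction n with
  | zero => simp [power_one]
  | succ n ih =>
    rw [power_succ, ih, power_succ, smul_mul_smul_comm, ← pow_succ]

theorem IsFAlgebra.mul_mem_principalIdeal (hf : IsFAlgebra A) {u v x y : A}
    (hu : 0 ≤ u) (hx : x ∈ principalIdeal u) (hy : y ∈ principalIdeal v) :
    x * y ∈ principalIdeal (u * v) := by
  obtain ⟨c, hc⟩ := mem_principalIdeal.1 hx
  obtain ⟨d, hd⟩ := mem_principalIdeal.1 hy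
  refine mem_principalIdeal.2 ⟨|c| * d, ?_⟩
  rw [hf.abs_mul, ← smul_mul_smul_comm]
  exact hf.mul_le_mul (hc.trans (smul_le_smul_of_nonneg_right (le_abs_self c) hu)) hd
    (abs_nonneg y) (smul_nonneg (abs_nonneg c) hu)

theorem IsFAlgebra.prod_mem_principalIdeal (hf : IsFAlgebra A) (n : ℕ) {e : A} (he : 0 ≤ e)
    (f : Fin (n + 1) → A) (hfe : ∀ i, f i ∈ principalIdeal e) :
    prod (n + 1) f ∈ principalIdeal (power e (n + 1)) := by
  induction n with
  | zero => exact hfe 0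
  | succ n ih =>
    exact hf.mul_mem_principalIdeal (hf.power_nonneg n he) (ih _ fun i => hfe _) (hfe _)

/-! ### Characters and products -/

/-- A functional dominated by a character is a multiple of it. -/
theorem IsCharacter.eq_mul_of_dominated {e : A} {χ ψ : A →ₗ[ℝ] ℝ} (he : 0 ≤ e)
    (hχ : IsCharacter e χ) {C : ℝ} (h : ∀ y ∈ principalIdeal e, |ψ y| ≤ C * χ |y|) {y : A}
    (hy : y ∈ principalIdeal e) : ψ y = ψ e * χ y := by
  have hmem : y - χ y • e ∈ principalIdeal e :=
    Submodule.sub_mem _ hy (Submodule.smul_mem _ _ (mem_principalIdeal_of_le he le_rfl))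
  have h0 : χ (y - χ y • e) = 0 := by
    rw [map_sub, map_smul, hχ.map_unit, smul_eq_mul, mul_one, sub_self]
  have h1 := h _ hmem
  rw [hχ.map_abs _ hmem, h0, abs_zero, mul_zero] at h1
  have h2 := abs_eq_zero.1 (le_antisymm h1 (abs_nonneg _))
  rw [map_sub, map_smul, smul_eq_mul] at h2
  linarith

theorem IsCharacter.comp_mulRight (hf : IsFAlgebra A) {u e : A} (hu : 0 ≤ u) (he : 0 ≤ e)
    {ω : A →ₗ[ℝ] ℝ} (hω : IsCharacter (u * e) ω) :
    IsCharacter u (ω ∘ₗ LinearMap.mulRight ℝ e) := by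
  refine ⟨hω.map_unit, fun x hx => ?_⟩
  have := hω.map_abs _ (hf.mul_mem_principalIdeal hu hx (mem_principalIdeal_of_le he le_rfl))
  rw [hf.abs_mul, abs_of_nonneg he] at this
  simpa using this

theorem IsCharacter.comp_mulLeft (hf : IsFAlgebra A) {u e : A} (he : 0 ≤ e)
    {ω : A →ₗ[ℝ] ℝ} (hω : IsCharacter (e * u) ω) :
    IsCharacter u (ω ∘ₗ LinearMap.mulLeft ℝ e) := by
  refine ⟨hω.map_unit, fun x hx => ?_⟩
  have := hω.map_abs _ (hf.mul_mem_principalIdeal he (mem_principalIdeal_of_le he le_rfl) hx)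
  rw [hf.abs_mul, abs_of_nonneg he] at this
  simpa using this

/-- Left multiplication by an element of the ideal of `u` is dominated by that by `u`. -/
theorem IsCharacter.exists_dominated (hf : IsFAlgebra A) {u e a : A} (hu : 0 ≤ u)
    {ω : A →ₗ[ℝ] ℝ} (hω : IsCharacter (u * e) ω) (ha : a ∈ principalIdeal u) :
    ∃ C : ℝ, ∀ y ∈ principalIdeal e, |ω (a * y)| ≤ C * ω (u * |y|) := by
  obtain ⟨c, hc⟩ := mem_principalIdeal.1 ha
  refine ⟨c, fun y hy => ?_⟩
  have hay := hf.mul_mem_principalIdeal hu ha hy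
  have huy := hf.mul_mem_principalIdeal hu (mem_principalIdeal_of_le hu le_rfl)
    (abs_mem_principalIdeal hy)
  rw [← hω.map_abs _ hay, ← smul_eq_mul c, ← map_smul]
  refine hω.mono (abs_mem_principalIdeal hay) (Submodule.smul_mem _ _ huy) ?_
  rw [hf.abs_mul, ← smul_mul_assoc]
  exact hf.mul_le_mul_right hc (abs_nonneg y)

/-- An Archimedean `f`-algebra is commutative. -/
theorem IsFAlgebra.mul_comm (hf : IsFAlgebra A) (harch : IsArchimedean A) (a b : A) :
    a * b = b * a := by
  set e := |a| + |b| with hedef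
  have he : 0 ≤ e := add_nonneg (abs_nonneg a) (abs_nonneg b)
  have hee : e ∈ principalIdeal e := mem_principalIdeal_of_le he le_rfl
  have ha : a ∈ principalIdeal e := mem_principalIdeal.2
    ⟨1, by rw [one_smul]; exact le_add_of_nonneg_right (abs_nonneg b)⟩
  have hb : b ∈ principalIdeal e := mem_principalIdeal.2
    ⟨1, by rw [one_smul]; exact le_add_of_nonneg_left (abs_nonneg a)⟩
  refine harch.eq_of_isCharacter (hf.mul_nonneg e e he he) (hf.mul_mem_principalIdeal he ha hb)
    (hf.mul_mem_principalIdeal he hb ha) fun ω hω => ?_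
  have h1 := hω.comp_mulRight hf he he
  have h2 := hω.comp_mulLeft hf he
  set χ₁ := ω ∘ₗ LinearMap.mulRight ℝ e
  set χ₂ := ω ∘ₗ LinearMap.mulLeft ℝ e
  have hmul : ∀ x ∈ principalIdeal e, ∀ y ∈ principalIdeal e, ω (x * y) = χ₁ x * χ₂ y := by
    intro x hx y hy
    obtain ⟨C, hC⟩ := hω.exists_dominated hf he hx
    exact h2.eq_mul_of_dominated (ψ := ω ∘ₗ LinearMap.mulLeft ℝ x) he hC hy
  have heq : ∀ x ∈ principalIdeal e, χ₁ x = χ₂ x := by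
    intro x hx
    have hmem : ∀ t : ℝ, x - t • e ∈ principalIdeal e := fun t =>
      Submodule.sub_mem _ hx (Submodule.smul_mem _ _ hee)
    have hpos : ∀ t : ℝ, (x - t • e)⁺ ∈ principalIdeal e := fun t => by
      refine isSolid_principalIdeal e (hmem t) ?_
      rw [abs_of_nonneg (posPart_nonneg _), ← posPart_add_negPart]
      exact le_add_of_nonneg_right (negPart_nonneg _)
    have hneg : ∀ t : ℝ, (x - t • e)⁻ ∈ principalIdeal e := fun t => by
      refine isSolid_principalIdeal e (hmem t) ?_
      rw [abs_of_nonneg (negPart_nonneg _), ← posPart_add_negPart]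
      exact le_add_of_nonneg_left (posPart_nonneg _)
    have hv1 : ∀ t : ℝ, χ₁ (x - t • e) = χ₁ x - t := fun t => by
      rw [map_sub, map_smul, h1.map_unit, smul_eq_mul, mul_one]
    have hv2 : ∀ t : ℝ, χ₂ (x - t • e) = χ₂ x - t := fun t => by
      rw [map_sub, map_smul, h2.map_unit, smul_eq_mul, mul_one]
    by_contra hne
    rcases lt_or_gt_of_ne hne with hlt | hlt
    · obtain ⟨t, ht1, ht2⟩ := exists_between hlt
      have h0 := hmul _ (hneg t) _ (hpos t)
      rw [hf.mul_eq_zero_of_inf (by rw [inf_comm]; exact posPart_inf_negPart_eq_zero _), map_zero,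
        h1.map_negPart (hmem t), h2.map_posPart (hmem t), hv1, hv2] at h0
      exact (mul_pos (negPart_pos (by linarith)) (posPart_pos (by linarith))).ne h0
    · obtain ⟨t, ht1, ht2⟩ := exists_between hlt
      have h0 := hmul _ (hpos t) _ (hneg t)
      rw [hf.mul_eq_zero_of_inf (posPart_inf_negPart_eq_zero _), map_zero,
        h1.map_posPart (hmem t), h2.map_negPart (hmem t), hv1, hv2] at h0
      exact (mul_pos (posPart_pos (by linarith)) (negPart_pos (by linarith))).ne h0
  rw [hmul a ha b hb, hmul b hb a ha, ← heq a ha, ← heq b hb, _root_.mul_comm]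

/-- A character at `e ^ (n + 1)` turns products of elements of the ideal of `e` into products of
the values of a character at `e`. -/
theorem IsCharacter.exists_map_prod (hf : IsFAlgebra A) (harch : IsArchimedean A) (n : ℕ) {e : A}
    (he : 0 ≤ e) {ω : A →ₗ[ℝ] ℝ} (hω : IsCharacter (power e (n + 1)) ω) :
    ∃ χ : A →ₗ[ℝ] ℝ, IsCharacter e χ ∧ ∀ f : Fin (n + 1) → A, (∀ i, f i ∈ principalIdeal e) →
      ω (prod (n + 1) f) = ∏ i, χ (f i) := by
  induction n generalizing ω with
  | zero => exact ⟨ω, hω, fun f _ => by simp [prod]⟩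
  | succ n ih =>
    have hu := hf.power_nonneg n he
    have hee : e ∈ principalIdeal e := mem_principalIdeal_of_le he le_rfl
    have hω2 : IsCharacter (power e (n + 1) * e) ω := hω
    obtain ⟨χ, hχ, hprod⟩ := ih (hω2.comp_mulRight hf hu he)
    refine ⟨χ, hχ, fun f hfe => ?_⟩
    have hpow : ∀ y ∈ principalIdeal e, ω (power e (n + 1) * y) = χ y := by
      intro y hy
      let g : Fin (n + 1) → A := Function.update (fun _ => e) (Fin.last n) y
      have hg : ∀ i, g i ∈ principalIdeal e := by
        intro i
        by_cases hi : i = Fin.last n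
        · subst hi
          simpa [g] using hy
        · simpa [g, hi] using hee
      have h1 : prod (n + 1) g * e = power e (n + 1) * y := by
        cases n with
        | zero =>
          have : prod 1 g = y := by simp [prod, g]
          rw [this, hf.mul_comm harch, power_one]
        | succ n =>
          have : prod (n + 2) g = power e (n + 1) * y := by
            rw [prod_succ]
            simp [g, power, Fin.castSucc_ne_last]
          rw [this, mul_assoc, hf.mul_comm harch y e, ← mul_assoc, power_succ]
      have h2 := hprod g hg
      simp only [LinearMap.comp_apply, LinearMap.mulRight_apply] at h2
      rw [← h1, h2, Fin.prod_univ_castSucc]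
      simp [g, Fin.castSucc_ne_last, hχ.map_unit]
    have hP := hf.prod_mem_principalIdeal n he (fun i => f i.castSucc) fun i => hfe _
    obtain ⟨C, hC⟩ := hω2.exists_dominated hf hu hP
    have h3 := hχ.eq_mul_of_dominated
      (ψ := ω ∘ₗ LinearMap.mulLeft ℝ (prod (n + 1) fun i => f i.castSucc)) (C := C) he (by
        intro y hy
        rw [← hpow _ (abs_mem_principalIdeal hy)]
        exact hC y hy) (hfe (Fin.last (n + 1)))
    have h4 := hprod (fun i => f i.castSucc) fun i => hfe _
    simp only [LinearMap.comp_apply, LinearMap.mulRight_apply, LinearMap.mulLeft_apply] at h3 h4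
    rw [prod_succ, h3, h4, Fin.prod_univ_castSucc fun i => χ (f i)]

/-- Products of nonnegative elements have roots in a uniformly complete `f`-algebra. -/
theorem IsFAlgebra.exists_root (hf : IsFAlgebra A) (harch : IsArchimedean A)
    (huc : IsUniformlyComplete A) (n : ℕ) (g : Fin (n + 1) → A) (hg : ∀ i, 0 ≤ g i) :
    ∃ r, 0 ≤ r ∧ r ≤ ∑ i, g i ∧ power r (n + 1) = prod (n + 1) g := by
  set e := ∑ i, g i with hedef
  have he : 0 ≤ e := Finset.sum_nonneg fun i _ => hg i
  have hge : ∀ i, g i ≤ e := fun i =>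
    Finset.single_le_sum (f := g) (fun j _ => hg j) (Finset.mem_univ i)
  have hee : e ∈ principalIdeal e := mem_principalIdeal_of_le he le_rfl
  have hmem := fun i => mem_principalIdeal_of_le (hg i) (hge i)
  let F : C(Fin (n + 1) → Set.Icc (0 : ℝ) 1, ℝ) :=
    ⟨fun t => (∏ i, (t i : ℝ)) ^ (((n + 1 : ℕ) : ℝ)⁻¹),
      Continuous.rpow_const (by fun_prop) fun t => Or.inr (by positivity)⟩
  have hF0 : ∀ t : Fin (n + 1) → Set.Icc (0 : ℝ) 1, 0 ≤ ∏ i, (t i : ℝ) := fun t =>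
    Finset.prod_nonneg fun i _ => (t i).2.1
  obtain ⟨r, hr, hrF⟩ := exists_represents harch huc he hg hge F
  refine ⟨r, ?_, ?_, ?_⟩
  · refine harch.nonneg_of_isCharacter he hr fun χ hχ => ?_
    obtain ⟨t, ht⟩ := hχ.exists_point hg hge
    rw [hrF χ hχ t ht]
    exact Real.rpow_nonneg (hF0 t) _
  · refine harch.le_of_isCharacter he hr hee fun χ hχ => ?_
    obtain ⟨t, ht⟩ := hχ.exists_point hg hge
    rw [hrF χ hχ t ht, hχ.map_unit]
    exact Real.rpow_le_one (hF0 t) (Finset.prod_le_one (fun i _ => (t i).2.1) fun i _ => (t i).2.2)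
      (by positivity)
  · refine harch.eq_of_isCharacter (hf.power_nonneg n he)
      (hf.prod_mem_principalIdeal n he _ fun _ => hr)
      (hf.prod_mem_principalIdeal n he _ hmem) fun ω hω => ?_
    obtain ⟨χ, hχ, hprod⟩ := hω.exists_map_prod hf harch n he
    obtain ⟨t, ht⟩ := hχ.exists_point hg hge
    rw [power, hprod _ fun _ => hr, hprod _ hmem, hrF χ hχ t ht]
    simp only [Finset.prod_const, Finset.card_univ, Fintype.card_fin, ← ht]
    exact Real.rpow_inv_natCast_pow (hF0 t) (Nat.succ_ne_zero n)

end Multiplication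

section FiniteElements

variable {V : Type*} [AddCommGroup V] [Lattice V] [IsOrderedAddMonoid V] [Module ℝ V]
  [IsOrderedModule ℝ V]

theorem finiteElements_of_abs_le {φ ψ : V} (hψ : ψ ∈ finiteElements V) (h : |φ| ≤ |ψ|) :
    φ ∈ finiteElements V := by
  obtain ⟨z, hz, hmaj⟩ := hψ
  refine ⟨z, hz, fun x => ?_⟩
  obtain ⟨c, hc, hn⟩ := hmaj x
  exact ⟨c, hc, fun n => (inf_le_inf_left _ (nsmul_le_nsmul_right h n)).trans (hn n)⟩

theorem zero_mem_finiteElements : (0 : V) ∈ finiteElements V :=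
  ⟨0, le_rfl, fun x => ⟨1, one_pos, fun n => by simp⟩⟩

theorem add_mem_finiteElements {φ ψ : V} (hφ : φ ∈ finiteElements V) (hψ : ψ ∈ finiteElements V) :
    φ + ψ ∈ finiteElements V := by
  obtain ⟨y, hy, hφ⟩ := hφ
  obtain ⟨z, hz, hψ⟩ := hψ
  refine ⟨y + z, add_nonneg hy hz, fun x => ?_⟩
  obtain ⟨c, hc, hcn⟩ := hφ x
  obtain ⟨d, hd, hdn⟩ := hψ x
  refine ⟨c + d, add_pos hc hd, fun n => ?_⟩
  calc |x| ⊓ n • |φ + ψ| ≤ |x| ⊓ (n • |φ| + n • |ψ|) := by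
        rw [← nsmul_add]
        exact inf_le_inf_left _ (nsmul_le_nsmul_right (abs_add_le φ ψ) n)
    _ ≤ |x| ⊓ n • |φ| + |x| ⊓ n • |ψ| := inf_add_le_add_inf (abs_nonneg x)
        (nsmul_nonneg (abs_nonneg φ) n) (nsmul_nonneg (abs_nonneg ψ) n)
    _ ≤ c • y + d • z := add_le_add (hcn n) (hdn n)
    _ ≤ (c + d) • y + (c + d) • z := add_le_add
        (smul_le_smul_of_nonneg_right (by linarith) hy)
        (smul_le_smul_of_nonneg_right (by linarith) hz)
    _ = (c + d) • (y + z) := (smul_add _ _ _).symm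

theorem sum_mem_finiteElements {ι : Type*} (s : Finset ι) (f : ι → V)
    (h : ∀ i ∈ s, f i ∈ finiteElements V) : ∑ i ∈ s, f i ∈ finiteElements V :=
  Finset.sum_induction f (· ∈ finiteElements V) (fun _ _ => add_mem_finiteElements)
    zero_mem_finiteElements h

/-- The band generated by a finite element consists of finite elements. -/
theorem finiteElements_of_disjoint (harch : IsArchimedean V) {φ r : V}
    (hr : r ∈ finiteElements V) (h : ∀ w : V, w ⊓ |r| = 0 → w ⊓ |φ| = 0) :
    φ ∈ finiteElements V := by
  obtain ⟨z, hz, hmaj⟩ := hr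
  refine ⟨z, hz, fun x => ?_⟩
  obtain ⟨c, hc, hcn⟩ := hmaj x
  refine ⟨c, hc, fun n => ?_⟩
  set y := |x| ⊓ n • |φ| with hy
  have hy0 : 0 ≤ y := le_inf (abs_nonneg x) (nsmul_nonneg (abs_nonneg φ) n)
  have hcz : 0 ≤ c • z := smul_nonneg hc.le hz
  have hd0 := posPart_nonneg (y - c • z)
  have hdy : (y - c • z)⁺ ≤ y := sup_le (sub_le_self _ hcz) hy0
  have hdr : (y - c • z)⁺ ⊓ |r| = 0 := by
    refine harch _ y (le_inf hd0 (abs_nonneg r)) hy0 fun k => ?_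
    induction k with
    | zero => simpa using hy0
    | succ k ih =>
      have h1 : k • ((y - c • z)⁺ ⊓ |r|) ≤ y ⊓ k • |r| :=
        le_inf ih (nsmul_le_nsmul_right inf_le_right k)
      have h2 : y ⊓ k • |r| ≤ c • z := (inf_le_inf_right _ inf_le_left).trans (hcn k)
      have h3 : (y - c • z)⁺ ≤ y - y ⊓ k • |r| :=
        sup_le (sub_le_sub_left h2 y) (sub_nonneg.2 inf_le_left)
      rw [succ_nsmul]
      calc _ ≤ y ⊓ k • |r| + (y - y ⊓ k • |r|) := add_le_add h1 (inf_le_left.trans h3)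
        _ = y := add_sub_cancel _ _
  have hdφ : (y - c • z)⁺ ⊓ n • |φ| = 0 := by
    have := inf_smul_eq_zero (h _ hdr) (zero_le_one (α := ℝ)) (Nat.cast_nonneg (α := ℝ) n)
    rwa [one_smul, Nat.cast_smul_eq_nsmul] at this
  rw [inf_eq_left.2 (hdy.trans inf_le_right)] at hdφ
  exact sub_nonpos.1 (posPart_eq_zero.1 hdφ)

end FiniteElements

section ProductAlgebra

variable {A : Type*} [NonUnitalRing A] [Lattice A] [IsOrderedAddMonoid A]
  [Module ℝ A] [IsOrderedModule ℝ A] [IsScalarTower ℝ A A] [SMulCommClass ℝ A A]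

theorem power_mem_productAlgebra (a : A) (p : ℕ) : power a p ∈ productAlgebra A p :=
  ⟨fun _ => a, rfl⟩

variable (hf : IsFAlgebra A) (harch : IsArchimedean A) (huc : IsUniformlyComplete A)
include hf harch huc

theorem exists_root_of_mem (n : ℕ) {x : A} (hx : x ∈ productAlgebra A (n + 1)) :
    ∃ r, 0 ≤ r ∧ power r (n + 1) = |x| := by
  obtain ⟨g, rfl⟩ := hx
  obtain ⟨r, hr, -, h⟩ := hf.exists_root harch huc n (fun i => |g i|) fun i => abs_nonneg _
  exact ⟨r, hr, h.trans (hf.abs_prod n g).symm⟩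

theorem abs_mem_productAlgebra (n : ℕ) {x : A} (hx : x ∈ productAlgebra A (n + 1)) :
    |x| ∈ productAlgebra A (n + 1) := by
  obtain ⟨r, -, hr⟩ := exists_root_of_mem hf harch huc n hx
  exact hr ▸ power_mem_productAlgebra r (n + 1)

theorem smul_mem_productAlgebra (n : ℕ) {x : A} (hx : x ∈ productAlgebra A (n + 1)) (h0 : 0 ≤ x)
    {c : ℝ} (hc : 0 ≤ c) : c • x ∈ productAlgebra A (n + 1) := by
  obtain ⟨r, -, hr⟩ := exists_root_of_mem hf harch huc n hx
  rw [abs_of_nonneg h0] at hr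
  rw [← hr, ← Real.rpow_inv_natCast_pow hc (Nat.succ_ne_zero n), ← power_smul]
  exact power_mem_productAlgebra _ _

theorem inf_mem_productAlgebra (n : ℕ) {x y : A} (hx : x ∈ productAlgebra A (n + 1))
    (hy : y ∈ productAlgebra A (n + 1)) (hx0 : 0 ≤ x) (hy0 : 0 ≤ y) :
    x ⊓ y ∈ productAlgebra A (n + 1) := by
  obtain ⟨r, hr, hrx⟩ := exists_root_of_mem hf harch huc n hx
  obtain ⟨s, hs, hsy⟩ := exists_root_of_mem hf harch huc n hy
  rw [abs_of_nonneg hx0] at hrx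
  rw [abs_of_nonneg hy0] at hsy
  rw [← hrx, ← hsy, ← hf.power_inf n hr hs]
  exact power_mem_productAlgebra _ _

/-- Majorants in the product algebra can be computed with the lattice operations of `A`. -/
theorem isMajorantIn_productAlgebra_iff (n : ℕ) {φ z : A} (hφ : φ ∈ productAlgebra A (n + 1)) :
    IsMajorantIn (productAlgebra A (n + 1)) φ z ↔ z ∈ productAlgebra A (n + 1) ∧ 0 ≤ z ∧
      ∀ x ∈ productAlgebra A (n + 1), ∃ c : ℝ, 0 < c ∧ ∀ k : ℕ, |x| ⊓ k • |φ| ≤ c • z := by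
  have hmod : ∀ x ∈ productAlgebra A (n + 1), IsModulusIn (productAlgebra A (n + 1)) x |x| :=
    fun x hx => ⟨abs_mem_productAlgebra hf harch huc n hx, le_abs_self x, neg_le_abs x,
      fun y _ h1 h2 => abs_le'.2 ⟨h1, h2⟩⟩
  have hinf : ∀ x ∈ productAlgebra A (n + 1), ∀ k : ℕ,
      |x| ⊓ k • |φ| ∈ productAlgebra A (n + 1) := by
    intro x hx k
    have hk : k • |φ| ∈ productAlgebra A (n + 1) := by
      rw [← Nat.cast_smul_eq_nsmul ℝ]
      exact smul_mem_productAlgebra hf harch huc n (abs_mem_productAlgebra hf harch huc n hφ)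
        (abs_nonneg φ) k.cast_nonneg
    exact inf_mem_productAlgebra hf harch huc n (abs_mem_productAlgebra hf harch huc n hx) hk
      (abs_nonneg x) (nsmul_nonneg (abs_nonneg φ) k)
  refine and_congr_right fun _ => and_congr_right fun _ => forall₂_congr fun x hx =>
    exists_congr fun c => and_congr_right fun _ => forall_congr' fun k => ⟨?_, fun h => ?_⟩
  · rintro ⟨a, m, w, ha, hm, hw, hle⟩
    refine (hw.2.2.2 _ (hinf x hx k) ?_ ?_).trans hle
    · exact inf_le_left.trans (abs_le'.2 ⟨ha.2.1, ha.2.2.1⟩)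
    · exact inf_le_right.trans (nsmul_le_nsmul_right (abs_le'.2 ⟨hm.2.1, hm.2.2.1⟩) k)
  · exact ⟨|x|, |φ|, _, hmod x hx, hmod φ hφ,
      ⟨hinf x hx k, inf_le_left, inf_le_right, fun y _ h1 h2 => le_inf h1 h2⟩, h⟩

theorem prod_mem_finiteElementsIn (n : ℕ) (g : Fin (n + 1) → A)
    (hg : ∀ i, g i ∈ finiteElements A) :
    prod (n + 1) g ∈ finiteElementsIn (productAlgebra A (n + 1)) := by
  have hmem : prod (n + 1) g ∈ productAlgebra A (n + 1) := ⟨g, rfl⟩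
  obtain ⟨r, hr, hrle, hrp⟩ := hf.exists_root harch huc n (fun i => |g i|) fun i => abs_nonneg _
  have hrfin : r ∈ finiteElements A := by
    refine finiteElements_of_abs_le (sum_mem_finiteElements Finset.univ (fun i => |g i|)
      fun i _ => finiteElements_of_abs_le (hg i) (abs_abs _).le) ?_
    rw [abs_of_nonneg hr]
    exact hrle.trans (le_abs_self _)
  obtain ⟨z, hz, hmaj⟩ := hrfin
  refine ⟨hmem, power z (n + 1), (isMajorantIn_productAlgebra_iff hf harch huc n hmem).2
    ⟨power_mem_productAlgebra _ _, hf.power_nonneg n hz, fun x hx => ?_⟩⟩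
  obtain ⟨k, hk, hkx⟩ := exists_root_of_mem hf harch huc n hx
  obtain ⟨c, hc, hcn⟩ := hmaj k
  refine ⟨c ^ (n + 1), pow_pos hc _, fun m => ?_⟩
  rw [abs_of_nonneg hk, abs_of_nonneg hr] at hcn
  have hmr : 0 ≤ m • r := nsmul_nonneg hr m
  rw [← hkx, hf.abs_prod, ← hrp, ← power_smul]
  refine le_trans ?_ (hf.power_mono n (le_inf hk hmr) (hcn m))
  rw [hf.power_inf n hk hmr]
  refine inf_le_inf_left _ ?_
  rw [← Nat.cast_smul_eq_nsmul ℝ, ← Nat.cast_smul_eq_nsmul ℝ, power_smul]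
  refine smul_le_smul_of_nonneg_right ?_ (hf.power_nonneg n hr)
  exact_mod_cast Nat.le_self_pow (Nat.succ_ne_zero n) m

theorem root_mem_finiteElements (hs : IsSemiprime A) (n : ℕ) {φ r : A}
    (hφ : φ ∈ finiteElementsIn (productAlgebra A (n + 1))) (hr : |power r (n + 1)| = |φ|) :
    r ∈ finiteElements A := by
  obtain ⟨hmem, z, hz⟩ := hφ
  obtain ⟨hzS, hz0, hmaj⟩ := (isMajorantIn_productAlgebra_iff hf harch huc n hmem).1 hz
  obtain ⟨t, ht, htz⟩ := exists_root_of_mem hf harch huc n hzS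
  rw [abs_of_nonneg hz0] at htz
  rw [hf.abs_power] at hr
  refine ⟨t, ht, fun x => ?_⟩
  obtain ⟨c, hc, hcn⟩ := hmaj _ (power_mem_productAlgebra x (n + 1))
  refine ⟨c + 1, by positivity, fun k => ?_⟩
  have hkr : 0 ≤ k • |r| := nsmul_nonneg (abs_nonneg r) k
  refine hf.le_of_power_le hs n (le_inf (abs_nonneg x) hkr) (smul_nonneg (by positivity) ht) ?_
  rw [hf.power_inf n (abs_nonneg x) hkr, power_smul, htz]
  have h1 : power (k • |r|) (n + 1) = (k ^ (n + 1)) • |φ| := by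
    rw [← Nat.cast_smul_eq_nsmul ℝ, power_smul, hr, ← Nat.cast_smul_eq_nsmul ℝ, Nat.cast_pow]
  rw [h1, ← hf.abs_power]
  refine (hcn _).trans (smul_le_smul_of_nonneg_right ?_ hz0)
  calc c ≤ c + 1 := by linarith
    _ ≤ (c + 1) ^ (n + 1) := le_self_pow₀ (by linarith) (Nat.succ_ne_zero n)

theorem existsUnique_root (hs : IsSemiprime A) (n : ℕ) {x : A}
    (hx : x ∈ productAlgebra A (n + 1)) : ∃! r : A, 0 ≤ r ∧ power r (n + 1) = |x| := by
  obtain ⟨r, hr, hrx⟩ := exists_root_of_mem hf harch huc n hx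
  refine ⟨r, ⟨hr, hrx⟩, fun s ⟨hs0, hsx⟩ => le_antisymm ?_ ?_⟩
  · exact hf.le_of_power_le hs n hs0 hr (hsx.trans hrx.symm).le
  · exact hf.le_of_power_le hs n hr hs0 (hrx.trans hsx.symm).le

theorem finiteElementsIn_productAlgebra_subset (hs : IsSemiprime A) (n : ℕ) :
    finiteElementsIn (productAlgebra A (n + 1)) ⊆ finiteElements A := by
  intro φ hφ
  obtain ⟨r, hr, hrφ⟩ := exists_root_of_mem hf harch huc n hφ.1
  have hfin : r ∈ finiteElements A :=
    root_mem_finiteElements hf harch huc hs n hφ (by rw [hrφ, abs_abs])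
  refine finiteElements_of_disjoint harch hfin fun w hw => ?_
  rw [abs_of_nonneg hr] at hw
  rw [← hrφ]
  exact hf.inf_power n hw

omit harch huc [Module ℝ A] [IsOrderedModule ℝ A] [IsScalarTower ℝ A A] [SMulCommClass ℝ A A] in
theorem HasWeakFactorization.exists_le_power (hw : HasWeakFactorization A) (n : ℕ) (z : A) :
    ∃ t, 0 ≤ t ∧ z ≤ power t (n + 1) := by
  induction n generalizing z with
  | zero => exact ⟨|z|, abs_nonneg z, le_abs_self z⟩
  | succ n ih =>
    obtain ⟨b, c, hbc⟩ := hw z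
    obtain ⟨t, ht, hbt⟩ := ih |b|
    have h0 := add_nonneg ht (abs_nonneg c)
    refine ⟨t + |c|, h0, (hbc.trans (le_abs_self _)).trans ?_⟩
    rw [hf.abs_mul, power_succ]
    exact hf.mul_le_mul (hbt.trans (hf.power_mono n ht (le_add_of_nonneg_right (abs_nonneg c))))
      (le_add_of_nonneg_left ht) (abs_nonneg c) (hf.power_nonneg n h0)

theorem mem_finiteElementsIn_of_hasWeakFactorization (hw : HasWeakFactorization A) (n : ℕ) {φ : A}
    (hφ : φ ∈ finiteElements A) (hmem : φ ∈ productAlgebra A (n + 1)) :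
    φ ∈ finiteElementsIn (productAlgebra A (n + 1)) := by
  obtain ⟨z, hz, hmaj⟩ := hφ
  obtain ⟨t, ht, hzt⟩ := hw.exists_le_power hf n z
  refine ⟨hmem, power t (n + 1), (isMajorantIn_productAlgebra_iff hf harch huc n hmem).2
    ⟨power_mem_productAlgebra _ _, hf.power_nonneg n ht, fun x _ => ?_⟩⟩
  obtain ⟨c, hc, hcn⟩ := hmaj x
  exact ⟨c, hc, fun k => (hcn k).trans (smul_le_smul_of_nonneg_left hzt hc.le)⟩

end ProductAlgebra

end FAlgebra

theorem corollary5 {A : Type*} [NonUnitalRing A] [Lattice A] [IsOrderedAddMonoid A]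
    [Module ℝ A] [IsOrderedModule ℝ A] [IsScalarTower ℝ A A] [SMulCommClass ℝ A A]
    (harch : FAlgebra.IsArchimedean A) (huc : FAlgebra.IsUniformlyComplete A)
    (hf : FAlgebra.IsFAlgebra A) (p : ℕ) (hp : 2 ≤ p) :
    -- 1. products of finite elements
    (∀ g : Fin p → A, (∀ i, g i ∈ FAlgebra.finiteElements A) →
      FAlgebra.prod p g ∈ FAlgebra.finiteElementsIn (FAlgebra.productAlgebra A p)) ∧
    (FAlgebra.IsSemiprime A →
      -- 2. roots of products that are finite in the product algebra
      (∀ g : Fin p → A,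
        FAlgebra.prod p g ∈ FAlgebra.finiteElementsIn (FAlgebra.productAlgebra A p) →
        (∃! r : A, 0 ≤ r ∧ FAlgebra.power r p = |FAlgebra.prod p g|) ∧
        (∀ r : A, FAlgebra.power r p = |FAlgebra.prod p g| → r ∈ FAlgebra.finiteElements A) ∧
        (∀ r : A, FAlgebra.power r p = FAlgebra.prod p g → r ∈ FAlgebra.finiteElements A)) ∧
      -- 3. roots of products of finite elements
      (∀ g : Fin p → A, (∀ i, g i ∈ FAlgebra.finiteElements A) →
        (∃! r : A, 0 ≤ r ∧ FAlgebra.power r p = |FAlgebra.prod p g|) ∧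
        (∀ r : A, FAlgebra.power r p = |FAlgebra.prod p g| → r ∈ FAlgebra.finiteElements A) ∧
        (∀ r : A, FAlgebra.power r p = FAlgebra.prod p g → r ∈ FAlgebra.finiteElements A)) ∧
      -- 4. inclusion
      FAlgebra.finiteElementsIn (FAlgebra.productAlgebra A p) ⊆ FAlgebra.finiteElements A ∧
      -- 5. equality under the weak factorization property
      (FAlgebra.HasWeakFactorization A →
        FAlgebra.finiteElementsIn (FAlgebra.productAlgebra A p) =
          FAlgebra.finiteElements A ∩ FAlgebra.productAlgebra A p)) := by
  obtain ⟨n, rfl⟩ : ∃ n, p = n + 1 := ⟨p - 1, by omega⟩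
  have hroot : FAlgebra.IsSemiprime A → ∀ g : Fin (n + 1) → A,
      FAlgebra.prod (n + 1) g ∈
        FAlgebra.finiteElementsIn (FAlgebra.productAlgebra A (n + 1)) →
      (∃! r : A, 0 ≤ r ∧ FAlgebra.power r (n + 1) = |FAlgebra.prod (n + 1) g|) ∧
      (∀ r : A, FAlgebra.power r (n + 1) = |FAlgebra.prod (n + 1) g| →
        r ∈ FAlgebra.finiteElements A) ∧
      (∀ r : A, FAlgebra.power r (n + 1) = FAlgebra.prod (n + 1) g →
        r ∈ FAlgebra.finiteElements A) := by
    intro hs g hg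
    refine ⟨FAlgebra.existsUnique_root hf harch huc hs n ⟨g, rfl⟩, fun r hr => ?_, fun r hr => ?_⟩
    · exact FAlgebra.root_mem_finiteElements hf harch huc hs n hg (by rw [hr, abs_abs])
    · exact FAlgebra.root_mem_finiteElements hf harch huc hs n hg (by rw [hr])
  have hprod := FAlgebra.prod_mem_finiteElementsIn hf harch huc n
  refine ⟨hprod, fun hs => ⟨hroot hs, fun g hg => hroot hs g (hprod g hg), ?_, fun hw => ?_⟩⟩
  · exact FAlgebra.finiteElementsIn_productAlgebra_subset hf harch huc hs n
  · refine Set.Subset.antisymm (fun φ hφ => ⟨?_, hφ.1⟩) fun φ hφ => ?_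
    · exact FAlgebra.finiteElementsIn_productAlgebra_subset hf harch huc hs n hφ
    · exact FAlgebra.mem_finiteElementsIn_of_hasWeakFactorization hf harch huc hw n hφ.1 hφ.2
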